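/- Scalars are $\mathbb{K}=\mathbb{R}$ or $\mathbb{C}$. For a topological space $X$, let $C_b(X)$ be the algebra of bounded continuous functions $X\to\mathbb{K}$ with the supremum norm; for $f\in C_b(X)$ let $\mathrm{Coz}(f)=\{x: f(x)\neq 0\}$ and $\mathrm{supp}(f)=\mathrm{cl}_X\,\mathrm{Coz}(f)$; let $\mathrm{Coz}(X)=\{\mathrm{Coz}(f):f\in C_b(X)\}$. Let $C_c(X)$ be the set of $f\in C_b(X)$ with compact support and $C_0(X)$ the set of $f\in C_b(X)$ such that $\{x:|f(x)|\ge\varepsilon\}$ is compact for every $\varepsilon>0$. Let $C_{\mathscr P}(X)$ be the set of $f\in C_b(X)$ such that $\mathrm{supp}(f)$ has a Lindelöf neighborhood in $X$ (that is, $\mathrm{supp}(f)\subseteq\mathrm{int}_X N$ for some Lindelöf $N\subseteq X$). For a completely regular Hausdorff space $X$ with Stone–Čech compactification $\beta X$, let $$\lambda_{\mathscr P}X=\bigcup\{\mathrm{int}_{\beta X}\mathrm{cl}_{\beta X}C : C\in\mathrm{Coz}(X)\text{ and }\mathrm{cl}_XC\text{ is Lindelöf}\}\subseteq\beta X ,$$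 with the subspace topology. "Isometrically isomorphic" means isomorphic through a linear, multiplicative, isometric bijection. Theorem. Let $X$ be a paracompact Hausdorff space in which every point has a Lindelöf neighborhood, and let $Y=\lambda_{\mathscr P}X$. Then $C_{\mathscr P}(X)$ is a subalgebra of $C_b(X)$ which is complete in the supremum norm (a Banach subalgebra). The space $Y$ is locally compact Hausdorff, $C_{\mathscr P}(X)$ is isometrically isomorphic to $C_c(Y)$, and every locally compact Hausdorff space $T$ for which $C_{\mathscr P}(X)$ is isometrically isomorphic to $C_c(T)$ is homeomorphic to $Y$. Moreover: 1. $C_{\mathscr P}(X)=\{f\in C_b(X):\mathrm{supp}(f)\text{ is Lindelöf}\}$. 2. $C_0(X)\subseteq C_{\mathscr P}(X)$, and the inclusion is proper if $X$ is not Lindelöf. 3. $C_c(Y)=C_0(Y)$. 4. $Y$ is countably compact. 5. If $X$ is not Lindelöf, then $Y$ is neither Lindelöf nor paracompact. If $X$ is in addition locally compact, then also: 6. $C_{\mathscr P}(X)=\{f\in C_b(X):\mathrm{supp}(f)\text{ is }\sigma\text{-compact}\}$. 7. If $X$ is not Lindelöf, then $Y$ is not normal. -/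

import Mathlib

open scoped BoundedContinuousFunction Topology

noncomputable section

namespace LindelofSupport

/-- Each point has a Lindelöf neighborhood. -/
def LocallyLindelof (X : Type*) [TopologicalSpace X] : Prop :=
  ∀ x : X, ∃ N ∈ 𝓝 x, IsLindelof N

/-- `C_P(X)` for `P` the Lindelöf property: the bounded continuous scalar functions whose support
has a Lindelöf neighborhood. -/
def CLindelof (𝕜 : Type*) [RCLike 𝕜] (X : Type*) [TopologicalSpace X] : Set (X →ᵇ 𝕜) :=
  {f | ∃ N ∈ 𝓝ˢ (tsupport f), IsLindelof N}

/-- `C_0(X)`: the bounded continuous scalar functions `f` for which `{|f| ≥ ε}` is compact for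
each `ε > 0`. -/
def CZero (𝕜 : Type*) [RCLike 𝕜] (X : Type*) [TopologicalSpace X] : Set (X →ᵇ 𝕜) :=
  {f | ∀ ε : ℝ, 0 < ε → IsCompact {x | ε ≤ ‖f x‖}}

/-- `C_c(X)`: the bounded continuous scalar functions with compact support, as a subalgebra of
`C_b(X)` (with the supremum norm). -/
def CCompact (𝕜 : Type*) [RCLike 𝕜] (X : Type*) [TopologicalSpace X] :
    NonUnitalSubalgebra 𝕜 (X →ᵇ 𝕜) where
  carrier := {f | HasCompactSupport f}
  add_mem' {f g} hf hg := by
    have h : HasCompactSupport ((f : X → 𝕜) + (g : X → 𝕜)) := HasCompactSupport.add hf hg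
    simpa using h
  zero_mem' := by
    have h : HasCompactSupport (0 : X → 𝕜) := HasCompactSupport.zero
    simpa using h
  mul_mem' {f g} hf _ := by
    have h : HasCompactSupport ((f : X → 𝕜) * (g : X → 𝕜)) := HasCompactSupport.mul_right hf
    simpa using h
  smul_mem' c f hf := by
    have h : HasCompactSupport ((fun _ : X => c) • (f : X → 𝕜)) := HasCompactSupport.smul_left hf
    exact h

/-- The cozero-sets of `X`: the sets `{x | f x ≠ 0}` for `f ∈ C_b(X)`. -/
def IsCozeroSet (𝕜 : Type*) [RCLike 𝕜] {X : Type*} [TopologicalSpace X] (C : Set X) : Prop :=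
  ∃ f : X →ᵇ 𝕜, C = Function.support f

/-- `λ_P X` for `P` the Lindelöf property, as a subset of the Stone–Čech compactification `βX`:
the union of `int_{βX} cl_{βX} C` over the cozero-sets `C` of `X` whose closure in `X` is
Lindelöf. -/
def lambdaLindelof (𝕜 : Type*) [RCLike 𝕜] (X : Type*) [TopologicalSpace X] :
    Set (StoneCech X) :=
  ⋃ C ∈ {C : Set X | IsCozeroSet 𝕜 C ∧ IsLindelof (closure C)},
    interior (closure (stoneCechUnit '' C))

/-- Two subalgebras of algebras of bounded continuous functions are isometrically isomorphic:
there is a linear isometric bijection between them that is multiplicative. -/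
def IsometricallyIsomorphic {𝕜 : Type*} [RCLike 𝕜] {X Y : Type*} [TopologicalSpace X]
    [TopologicalSpace Y] (A : NonUnitalSubalgebra 𝕜 (X →ᵇ 𝕜))
    (B : NonUnitalSubalgebra 𝕜 (Y →ᵇ 𝕜)) : Prop :=
  ∃ e : A ≃ₗᵢ[𝕜] B, ∀ f g : A, e (f * g) = e f * e g

end LindelofSupport

end

/-! A paracompact locally Lindelöf space splits into clopen Lindelöf pieces, the fibers of a locally
constant surjection `π : X → Q`. A closed set is Lindelöf exactly when it meets countably many
pieces, so `CLindelof` consists of the functions whose cozero-set has countable image under `π`.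
Completeness and the comparison with `CZero` then reduce to countable unions of countable sets.

The map `π` extends to `toUltrafilter`, from `βX` to the ultrafilters on `Q`, and `λ_P X` is the
preimage of the ultrafilters with a countable member (`mem_lambdaLindelof_iff`). It is the directed
union of the compact open sets `lambdaPart S`, `S` countable, and any countably many of these lie in
a single one; hence countable compactness and `C_c = C_0`. Functions in `CLindelof` extend uniquely
over `λ_P X` with compact support, and `C_c` of a locally compact Hausdorff space determines the
space through its characters.

Non-normality holds for every non-Lindelöf `X` and rules out Lindelöf and paracompact as well. A
section of `π` embeds `countableUltrafilters Q` as a closed subspace, and for uncountable `Q` this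
contains a closed copy of the same space over `ω₁ × ℕ`. There a coherent family of finite-to-one
functions `e a` yields two disjoint closed sets of free ultrafilters, living below and above the
graphs. Separating them would uniformize the family, which a counting argument excludes. -/

section

open Set Filter Topology

namespace LindelofSupport

/-! ### Coherent families of finite-to-one functions -/

section Coherent

variable {W : Type*} [LinearOrder W]

open Classical in
/-- A family of functions `W → ℕ` defined by recursion along sequences `s a` that enumerate the
predecessors of `a`. -/
noncomputable def coherentSeq [WellFoundedLT W] (s : W → ℕ → W) (a x : W) : ℕ :=
  if _h : ∃ n, x ≤ s a n ∧ s a n < a then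
    max (coherentSeq s (s a (sInf {n | x ≤ s a n ∧ s a n < a})) x)
      (sInf {n | x ≤ s a n ∧ s a n < a})
  else 0
termination_by wellFounded_lt (α := W).wrap a
decreasing_by exact (Nat.sInf_mem _h).2

theorem coherentSeq_spec [WellFoundedLT W] {s : W → ℕ → W} {a x : W} (h : ∃ n, x ≤ s a n ∧ s a n < a) :
    ∃ n, x ≤ s a n ∧ s a n < a ∧ coherentSeq s a x = max (coherentSeq s (s a n) x) n ∧
      ∀ m, x ≤ s a m → s a m < a → n ≤ m := by
  refine ⟨sInf {n | x ≤ s a n ∧ s a n < a}, (Nat.sInf_mem h).1, (Nat.sInf_mem h).2, ?_,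
    fun m h1 h2 => Nat.sInf_le ⟨h1, h2⟩⟩
  rw [coherentSeq, dif_pos h]

/-- Induction on `a`. Taking the maximum with `n` makes a value at most `k` force `n ≤ k`, so only
finitely many earlier functions are involved. For coherence with `b = s a m`, minimality gives `n ≤
m`; a disagreement at `x` means that the function at `s a n` is at most `n` there or already differs
from the one at `b`, and each happens finitely often. -/
theorem coherentSeq_finite [WellFoundedLT W] {s : W → ℕ → W} (hs : ∀ a, Iio a ⊆ range (s a)) (a : W) :
    (∀ k, {x | x ≤ a ∧ coherentSeq s a x ≤ k}.Finite) ∧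
      ∀ b < a, {x | x ≤ b ∧ coherentSeq s a x ≠ coherentSeq s b x}.Finite := by
  induction a using WellFoundedLT.induction with
  | ind a ih =>
  have hex : ∀ x < a, ∃ n, x ≤ s a n ∧ s a n < a := by
    intro x hx
    obtain ⟨n, hn⟩ := hs a hx
    exact ⟨n, hn.ge, hn ▸ hx⟩
  constructor
  · intro k
    -- The point `a` is added by hand: no `s a n < a` lies above it, so its value is the default
    -- `0`.
    have hfin : (insert a (⋃ n ∈ Iic k,
        {x | s a n < a ∧ x ≤ s a n ∧ coherentSeq s (s a n) x ≤ k})).Finite := by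
      refine Set.Finite.insert _ ((finite_Iic k).biUnion fun n _ => ?_)
      by_cases hn : s a n < a
      · exact ((ih _ hn).1 k).subset fun x hx => hx.2
      · simp [hn]
    refine hfin.subset ?_
    rintro x ⟨hxa, hxk⟩
    rcases hxa.eq_or_lt with rfl | hlt
    · exact mem_insert _ _
    · obtain ⟨n, h1, h2, h3, -⟩ := coherentSeq_spec (hex x hlt)
      rw [h3, max_le_iff] at hxk
      exact Or.inr (mem_biUnion (show n ∈ Iic k from hxk.2) ⟨h2, h1, hxk.1⟩)
  · intro b hb
    obtain ⟨m, rfl⟩ := hs a hb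
    have hfin : (⋃ n ∈ Iic m, {x | s a n < a ∧ x ≤ s a n ∧ x ≤ s a m ∧
        (coherentSeq s (s a n) x ≤ n ∨
          coherentSeq s (s a n) x ≠ coherentSeq s (s a m) x)}).Finite := by
      refine (finite_Iic m).biUnion fun n _ => ?_
      by_cases hn : s a n < a
      · have hne : {x | x ≤ s a n ∧ x ≤ s a m ∧
            coherentSeq s (s a n) x ≠ coherentSeq s (s a m) x}.Finite := by
          rcases lt_trichotomy (s a n) (s a m) with h | h | h
          · exact ((ih _ hb).2 _ h).subset fun x hx => ⟨hx.1, hx.2.2.symm⟩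
          · simp [h]
          · exact ((ih _ hn).2 _ h).subset fun x hx => ⟨hx.2.1, hx.2.2⟩
        refine (((ih _ hn).1 n).union hne).subset ?_
        rintro x ⟨-, h1, h2, h3 | h3⟩
        · exact Or.inl ⟨h1, h3⟩
        · exact Or.inr ⟨h1, h2, h3⟩
      · simp [hn]
    refine hfin.subset ?_
    rintro x ⟨hxm, hx⟩
    obtain ⟨n, h1, h2, h3, h4⟩ := coherentSeq_spec (hex x (hxm.trans_lt hb))
    refine mem_biUnion (show n ∈ Iic m from h4 m hxm hb) ⟨h2, h1, hxm, ?_⟩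
    by_contra! hcon
    rw [h3, max_eq_left hcon.1.le] at hx
    exact hx hcon.2

/-- On a well-order with countable initial segments there is a coherent family of finite-to-one
functions into `ℕ`. -/
theorem exists_coherent_finite_to_one [WellFoundedLT W] (hW : ∀ a : W, (Iio a).Countable) :
    ∃ e : W → W → ℕ, (∀ a k, {x | x ≤ a ∧ e a x ≤ k}.Finite) ∧
      ∀ a b, {x | x ≤ a ∧ x ≤ b ∧ e a x ≠ e b x}.Finite := by
  have hs : ∀ a : W, ∃ f : ℕ → W, Iio a ⊆ range f := fun a =>
    have : Nonempty W := ⟨a⟩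
    countable_iff_exists_subset_range.1 (hW a)
  choose s hs using hs
  refine ⟨coherentSeq s, fun a => (coherentSeq_finite hs a).1, fun a b => ?_⟩
  rcases lt_trichotomy a b with h | h | h
  · exact ((coherentSeq_finite hs b).2 a h).subset fun x hx => ⟨hx.1, hx.2.2.symm⟩
  · simp [h]
  · exact ((coherentSeq_finite hs a).2 b h).subset fun x hx => ⟨hx.2.1, hx.2.2⟩

theorem exists_forall_le_of_countable [Uncountable W] (hW : ∀ a : W, (Iio a).Countable)
    {S : Set W} (hS : S.Countable) : ∃ a, ∀ x ∈ S, x ≤ a := by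
  by_contra! h
  refine not_countable_univ (α := W) ((hS.biUnion fun x _ => hW x).mono fun a _ => ?_)
  obtain ⟨x, hx, hax⟩ := h a
  exact mem_biUnion hx hax

/-- An infinite set has a countably infinite subset, and countable subsets of `W` are bounded. -/
theorem finite_of_forall_inter_Iic [Uncountable W] (hW : ∀ a : W, (Iio a).Countable)
    {B : Set W} (hB : ∀ a, {x | x ≤ a ∧ x ∈ B}.Finite) : B.Finite := by
  by_contra hinf
  let f := Set.Infinite.natEmbedding B hinf
  obtain ⟨a, ha⟩ := exists_forall_le_of_countable hW (countable_range fun n => (f n : W))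
  refine Set.infinite_range_of_injective (f := fun n => (f n : W))
    (Subtype.val_injective.comp f.injective) ((hB a).subset fun x hx => ⟨ha x hx, ?_⟩)
  obtain ⟨n, rfl⟩ := hx
  exact (f n).2

/-- A coherent family of finite-to-one functions cannot be uniformized. -/
theorem not_exists_uniformization [Uncountable W] (hW : ∀ a : W, (Iio a).Countable)
    {e : W → W → ℕ} (he : ∀ a k, {x | x ≤ a ∧ e a x ≤ k}.Finite) (S : Set (W × ℕ))
    (hL : ∀ a, {q : W × ℕ | (q.1 ≤ a ∧ q.2 ≤ e a q.1) ∧ q ∉ S}.Finite)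
    (hM : ∀ a, {q : W × ℕ | (q.1 ≤ a ∧ e a q.1 < q.2) ∧ q ∈ S}.Finite) : False := by
  -- `G k` collects the `x` over which the section of `S` is exactly `{0, …, k}`. Below each `a`,
  -- almost every `x` lies in `G (e a x)`. As `e a` is finite-to-one, each `G k` is finite, and so
  -- is the set missed by all of them; `W` would be countable.
  let G : ℕ → Set W := fun k => {x | ∀ n, (x, n) ∈ S ↔ n ≤ k}
  have hexc : ∀ a, {x | x ≤ a ∧ x ∉ G (e a x)}.Finite := by
    intro a
    refine (((hL a).union (hM a)).image Prod.fst).subset ?_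
    rintro x ⟨hxa, hx⟩
    simp only [G, mem_ofPred_eq, not_forall] at hx
    obtain ⟨n, hn⟩ := hx
    refine ⟨(x, n), ?_, rfl⟩
    by_cases hle : n ≤ e a x
    · exact Or.inl ⟨⟨hxa, hle⟩, fun h => hn (iff_of_true h hle)⟩
    · exact Or.inr ⟨⟨hxa, not_le.1 hle⟩, by_contra fun h => hn (iff_of_false h hle)⟩
  have hG : ∀ k, (G k).Finite := by
    refine fun k => finite_of_forall_inter_Iic hW fun a => ?_
    refine ((hexc a).union (he a k)).subset ?_
    rintro x ⟨hxa, hx⟩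
    by_cases h : x ∈ G (e a x)
    · exact Or.inr ⟨hxa, (hx _).1 ((h _).2 le_rfl)⟩
    · exact Or.inl ⟨hxa, h⟩
  have hB : (⋃ k, G k)ᶜ.Finite := by
    refine finite_of_forall_inter_Iic hW fun a => (hexc a).subset ?_
    rintro x ⟨hxa, hx⟩
    exact ⟨hxa, fun h => hx (mem_iUnion_of_mem _ h)⟩
  refine not_countable_univ (α := W) ?_
  rw [← compl_union_self (⋃ k, G k)]
  exact hB.countable.union (countable_iUnion fun k => (hG k).countable)

end Coherent

/-! ### Non-normality of the space of ultrafilters with a countable member -/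

section Ultrafilters

/-- The ultrafilters on `D` that contain a countable set. -/
def countableUltrafilters (D : Type*) : Set (Ultrafilter D) :=
  {u | ∃ S ∈ u, S.Countable}

theorem exists_mem_pure_mem {D : Type*} {U : Set (Ultrafilter D)} (hU : IsOpen U)
    {u : Ultrafilter D} (hu : u ∈ U) {A : Set D} (hA : A ∈ u) : ∃ q ∈ A, pure q ∈ U := by
  have h : ∀ᶠ q in (u : Filter D), pure q ∈ U :=
    (Ultrafilter.tendsto_pure_self u) (hU.mem_nhds hu)
  exact (h.and hA).exists.imp fun q hq => ⟨hq.2, hq.1⟩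

theorem exists_free_ultrafilter {D : Type*} {A : Set D} (hA : A.Infinite) :
    ∃ u : Ultrafilter D, (u : Filter D) ≤ cofinite ∧ A ∈ u := by
  have := hA.cofinite_inf_principal_neBot
  refine ⟨Ultrafilter.of (cofinite ⊓ 𝓟 A), (Ultrafilter.of_le _).trans inf_le_left, ?_⟩
  exact (Ultrafilter.of_le (cofinite ⊓ 𝓟 A)).trans inf_le_right (mem_principal_self A)

/-- Near an ultrafilter containing the countable set `S`, all ultrafilters contain `S`. A free one
containing `S` and some `L b` contains `L a`, since only finitely many points are lost. Thus one
index `a` decides membership near a free ultrafilter. -/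
theorem isClosed_free_mem {D I : Type*} (L : I → Set D)
    (hL : ∀ S : Set D, S.Countable → ∃ a, ∀ b, ((S ∩ L b) \ L a).Finite) :
    IsClosed {u : countableUltrafilters D | (u.1 : Filter D) ≤ cofinite ∧ ∃ a, L a ∈ u.1} := by
  rw [← isOpen_compl_iff, isOpen_iff_mem_nhds]
  rintro ⟨u, S, hSu, hS⟩ hu
  have hnhds : ∀ A ∈ u, {v : countableUltrafilters D | A ∈ v.1} ∈ 𝓝 (⟨u, S, hSu, hS⟩ :
      countableUltrafilters D) := fun A hA =>
    ((ultrafilter_isOpen_basic A).preimage continuous_subtype_val).mem_nhds hA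
  obtain ⟨a, ha⟩ := hL S hS
  by_cases hfree : (u : Filter D) ≤ cofinite
  · have hLa : (L a)ᶜ ∈ u :=
      Ultrafilter.compl_mem_iff_notMem.2 fun h => hu ⟨hfree, a, h⟩
    filter_upwards [hnhds _ (inter_mem hSu hLa)]
    rintro ⟨v, hv'⟩ hv ⟨hvfree, b, hb⟩
    have h1 : ((S ∩ L b) \ L a) ∈ v := by
      filter_upwards [hv, hb] with q h1 h2 using ⟨⟨h1.1, h2⟩, h1.2⟩
    exact Ultrafilter.compl_notMem_iff.2 h1 (hvfree (ha b).compl_mem_cofinite)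
  · obtain ⟨F, hF, hFu⟩ := Filter.not_le.1 hfree
    filter_upwards [hnhds _ (Ultrafilter.compl_mem_iff_notMem.2 hFu)]
    rintro ⟨v, hv'⟩ hv ⟨hvfree, -⟩
    exact Ultrafilter.compl_mem_iff_notMem.1 hv (hvfree hF)

/-- The space of ultrafilters with a countable member on `W × ℕ` is not normal if `W` is an
uncountable well-order with countable initial segments. -/
theorem not_normalSpace_countableUltrafilters_prod {W : Type*} [LinearOrder W] [WellFoundedLT W]
    [Uncountable W] (hW : ∀ a : W, (Iio a).Countable) :
    ¬ NormalSpace (countableUltrafilters (W × ℕ)) := by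
  intro hnormal
  obtain ⟨e, he, hcoh⟩ := exists_coherent_finite_to_one hW
  -- The regions under and over the graph of `e a`. By coherence, changing `a` alters the `L` side
  -- only finitely over a common initial segment, and any `L a` meets any `M b` in a finite set.
  let L : W → Set (W × ℕ) := fun a => {q | q.1 ≤ a ∧ q.2 ≤ e a q.1}
  let M : W → Set (W × ℕ) := fun a => {q | q.1 ≤ a ∧ e a q.1 < q.2}
  have hfin : ∀ a b, {q : W × ℕ | (q.1 ≤ a ∧ q.1 ≤ b ∧ e a q.1 ≠ e b q.1) ∧
      q.2 ≤ max (e a q.1) (e b q.1)}.Finite := by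
    intro a b
    refine ((hcoh a b).biUnion fun x _ =>
      (finite_Iic (max (e a x) (e b x))).image (Prod.mk x)).subset ?_
    rintro ⟨x, n⟩ ⟨hx, hn⟩
    exact mem_biUnion hx ⟨n, hn, rfl⟩
  have hbound : ∀ S : Set (W × ℕ), S.Countable → ∃ a, ∀ q ∈ S, q.1 ≤ a := by
    intro S hS
    obtain ⟨a, ha⟩ := exists_forall_le_of_countable hW (hS.image Prod.fst)
    exact ⟨a, fun q hq => ha _ (mem_image_of_mem _ hq)⟩
  have hLc := isClosed_free_mem L fun S hS => by
    obtain ⟨a, ha⟩ := hbound S hS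
    refine ⟨a, fun b => (hfin a b).subset ?_⟩
    rintro q ⟨⟨hqS, hqb, hqe⟩, hqa⟩
    have h1 := ha q hqS
    have h2 : e a q.1 < q.2 := not_le.1 fun h => hqa ⟨h1, h⟩
    exact ⟨⟨h1, hqb, (h2.trans_le hqe).ne⟩, le_max_of_le_right hqe⟩
  have hMc := isClosed_free_mem M fun S hS => by
    obtain ⟨a, ha⟩ := hbound S hS
    refine ⟨a, fun b => (hfin a b).subset ?_⟩
    rintro q ⟨⟨hqS, hqb, hqe⟩, hqa⟩
    have h1 := ha q hqS
    have h2 : q.2 ≤ e a q.1 := not_lt.1 fun h => hqa ⟨h1, h⟩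
    exact ⟨⟨h1, hqb, (hqe.trans_le h2).ne'⟩, le_max_of_le_left h2⟩
  have hdisj : Disjoint
      {u : countableUltrafilters (W × ℕ) | (u.1 : Filter (W × ℕ)) ≤ cofinite ∧ ∃ a, L a ∈ u.1}
      {u : countableUltrafilters (W × ℕ) | (u.1 : Filter (W × ℕ)) ≤ cofinite ∧ ∃ a, M a ∈ u.1} := by
    rw [Set.disjoint_left]
    rintro u ⟨hfree, a, ha⟩ ⟨-, b, hb⟩
    have h1 : {q : W × ℕ | (q.1 ≤ a ∧ q.1 ≤ b ∧ e a q.1 ≠ e b q.1) ∧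
        q.2 ≤ max (e a q.1) (e b q.1)} ∈ u.1 := by
      filter_upwards [ha, hb] with q hqa hqb
      exact ⟨⟨hqa.1, hqb.1, (hqb.2.trans_le hqa.2).ne'⟩, le_max_of_le_left hqa.2⟩
    exact Ultrafilter.compl_notMem_iff.2 h1 (hfree (hfin a b).compl_mem_cofinite)
  obtain ⟨U, V, hU, hV, hLU, hMV, hUV⟩ := hnormal.normal _ _ hLc hMc hdisj
  obtain ⟨U, hUo, rfl⟩ := isOpen_induced_iff.1 hU
  obtain ⟨V, hVo, rfl⟩ := isOpen_induced_iff.1 hV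
  have hcount : ∀ a, {q : W × ℕ | q.1 ≤ a}.Countable := by
    intro a
    refine (((hW a).insert a).prod (countable_univ (α := ℕ))).mono ?_
    rintro ⟨x, n⟩ hx
    exact ⟨(le_iff_eq_or_lt.1 hx), mem_univ _⟩
  have hmem : ∀ {u : Ultrafilter (W × ℕ)} {a} {A : Set (W × ℕ)}, A ∈ u → (∀ q ∈ A, q.1 ≤ a) →
      u ∈ countableUltrafilters (W × ℕ) := fun {u a A} hA h =>
    ⟨A, hA, (hcount a).mono fun q hq => h q hq⟩
  -- The uniformizing set is the trace of `U` on the principal ultrafilters. An infinite exceptional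
  -- set would carry a free ultrafilter in one of the closed sets, hence in `U` or `V`; principal
  -- ultrafilters at exceptional points would then approximate it from within that open set.
  refine not_exists_uniformization hW he {q | pure q ∈ U} (fun a => ?_) (fun a => ?_)
  · by_contra hinf
    obtain ⟨u, hfree, hu⟩ := exists_free_ultrafilter hinf
    have huU : u ∈ U := @hLU ⟨u, hmem hu fun q hq => hq.1.1⟩
      ⟨hfree, a, mem_of_superset hu fun q hq => hq.1⟩
    obtain ⟨q, hq, hqU⟩ := exists_mem_pure_mem hUo huU hu
    exact hq.2 hqU
  · by_contra hinf
    obtain ⟨u, hfree, hu⟩ := exists_free_ultrafilter hinf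
    have huV : u ∈ V := @hMV ⟨u, hmem hu fun q hq => hq.1.1⟩
      ⟨hfree, a, mem_of_superset hu fun q hq => hq.1⟩
    obtain ⟨q, hq, hqV⟩ := exists_mem_pure_mem hVo huV hu
    have hqE : (pure q : Ultrafilter (W × ℕ)) ∈ countableUltrafilters (W × ℕ) :=
      ⟨{q}, Ultrafilter.mem_pure.2 rfl, countable_singleton q⟩
    exact Set.disjoint_left.1 hUV
      (show (⟨pure q, hqE⟩ : countableUltrafilters (W × ℕ)) ∈ _ from hq.2) hqV

theorem continuous_ultrafilter_map {A B : Type*} (f : A → B) :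
    Continuous (Ultrafilter.map f) := by
  refine ultrafilterBasis_is_basis.continuous_iff.2 ?_
  rintro _ ⟨s, rfl⟩
  exact ultrafilter_isOpen_basic (f ⁻¹' s)

theorem map_mem_countableUltrafilters {A B : Type*} (f : A → B) {u : Ultrafilter A}
    (hu : u ∈ countableUltrafilters A) : u.map f ∈ countableUltrafilters B := by
  obtain ⟨S, hSu, hS⟩ := hu
  exact ⟨f '' S, Ultrafilter.mem_map.2 (mem_of_superset hSu (subset_preimage_image f S)), hS.image f⟩

/-- The space of ultrafilters with a countable member on an uncountable set is not normal. -/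
theorem not_normalSpace_countableUltrafilters (Q : Type*) [Uncountable Q] :
    ¬ NormalSpace (countableUltrafilters Q) := by
  intro hnormal
  let W : Type := (Cardinal.aleph 1).ord.ToType
  have hWcard : Cardinal.mk W = Cardinal.aleph 1 := by simp [W]
  have hW : ∀ a : W, (Iio a).Countable := by
    intro a
    rw [← Cardinal.le_aleph0_iff_set_countable, ← Cardinal.lt_aleph_one_iff]
    exact (Cardinal.mk_Iio_lt a (by simp [W])).trans_eq hWcard
  have : Uncountable W := by
    rw [← Cardinal.aleph0_lt_mk_iff, hWcard]
    exact Cardinal.aleph0_lt_aleph_one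
  obtain ⟨j⟩ : Nonempty ((W × ℕ) ↪ Q) := by
    rw [← Cardinal.lift_mk_le']
    simp [hWcard]
  -- Pushing forward along `j` and its left inverse makes the space over `W × ℕ` a retract, hence a
  -- closed subspace, of the space over `Q`.
  have hr := Function.leftInverse_invFun j.injective
  refine not_normalSpace_countableUltrafilters_prod hW ?_
  have hleft : Function.LeftInverse
      (fun u : countableUltrafilters Q => (⟨u.1.map (Function.invFun j),
        map_mem_countableUltrafilters _ u.2⟩ : countableUltrafilters (W × ℕ)))
      (fun u => ⟨u.1.map j, map_mem_countableUltrafilters _ u.2⟩) := by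
    intro u
    apply Subtype.ext
    simp [Ultrafilter.map_map, hr.comp_eq_id]
  exact (hleft.isClosedEmbedding
    (((continuous_ultrafilter_map _).comp continuous_subtype_val).subtype_mk _)
    (((continuous_ultrafilter_map _).comp continuous_subtype_val).subtype_mk _)).normalSpace

end Ultrafilters

-- Decomposition into clopen Lindelöf pieces

universe u

/-- A paracompact locally Lindelöf space is a disjoint union of clopen Lindelöf subspaces. -/
theorem exists_isLocallyConstant_isLindelof_fiber (X : Type u) [TopologicalSpace X]
    [ParacompactSpace X] (hX : LocallyLindelof X) :
    ∃ (Q : Type u) (π : X → Q), Function.Surjective π ∧ IsLocallyConstant π ∧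
      ∀ q, IsLindelof (π ⁻¹' {q}) := by
  choose N hN hNL using hX
  obtain ⟨v, hvo, hvc, hvf, hvN⟩ := precise_refinement (fun x => interior (N x))
    (fun x => isOpen_interior)
    (eq_univ_of_forall fun x => mem_iUnion_of_mem x (mem_interior_iff_mem_nhds.2 (hN x)))
  let r : X → X → Prop := fun i j => (v i ∩ v j).Nonempty
  have hr : ∀ {i j}, r i j → r j i := fun ⟨x, hi, hj⟩ => ⟨x, hj, hi⟩
  -- The Lindelöf set `N i ⊇ v i` is covered by countably many open sets, each meeting finitely many
  -- members of the refinement.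
  have hrc : ∀ i, {j | r i j}.Countable := by
    intro i
    choose O hO hOf using hvf
    obtain ⟨t, ht, -, hit⟩ := (hNL i).elim_nhds_subcover O fun x _ => hO x
    refine (ht.biUnion fun x _ => (hOf x).countable).mono ?_
    rintro j ⟨y, hyi, hyj⟩
    obtain ⟨x, hx, hyx⟩ := mem_iUnion₂.1 (hit (interior_subset (hvN i hyi)))
    exact mem_biUnion hx ⟨y, hyj, hyx⟩
  have hidx : ∀ x, ∃ i, x ∈ v i := fun x => mem_iUnion.1 (hvc ▸ mem_univ x)
  choose idx hidx using hidx
  let ρ : X → Quot r := fun x => Quot.mk r (idx x)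
  have hρ : ∀ {x i}, x ∈ v i → ρ x = Quot.mk r i := fun {x i} h =>
    Quot.sound ⟨x, hidx x, h⟩
  have hloc : IsLocallyConstant ρ := (IsLocallyConstant.iff_exists_open _).2 fun x =>
    ⟨v (idx x), hvo _, hidx x, fun y hy => hρ hy⟩
  have hclass : ∀ i, ∃ A : Set X, A.Countable ∧ ∀ j, Quot.mk r j = Quot.mk r i → j ∈ A := by
    intro i
    -- `A n` holds the indices reached from `i` by chains of `n` overlaps. Their union is closed
    -- under `r` in both directions, so it contains the whole class of `i`.
    let A : ℕ → Set X := fun n => Nat.rec {i} (fun _ B => ⋃ j ∈ B, {k | r j k}) n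
    have hAc : ∀ n, (A n).Countable := by
      intro n
      induction n with
      | zero => exact countable_singleton i
      | succ n ih => exact ih.biUnion fun j _ => hrc j
    have hstep : ∀ {j k}, r j k → j ∈ ⋃ n, A n → k ∈ ⋃ n, A n := by
      intro j k hjk hj
      obtain ⟨n, hn⟩ := mem_iUnion.1 hj
      exact mem_iUnion.2 ⟨n + 1, mem_biUnion hn hjk⟩
    refine ⟨⋃ n, A n, countable_iUnion hAc, fun j hj => ?_⟩
    let P : Quot r → Prop := Quot.lift (· ∈ ⋃ n, A n) fun a b hab =>
      propext ⟨hstep hab, hstep (hr hab)⟩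
    have hPi : P (Quot.mk r i) := mem_iUnion.2 ⟨0, mem_singleton i⟩
    exact (hj ▸ hPi : P (Quot.mk r j))
  have hfib : ∀ x, IsLindelof (ρ ⁻¹' {ρ x}) := by
    intro x
    obtain ⟨A, hA, hAr⟩ := hclass (idx x)
    refine (hA.isLindelof_biUnion fun i _ => hNL i).of_isClosed_subset
      (hloc.isClosed_fiber _) ?_
    intro y hy
    exact mem_biUnion (hAr _ hy) (interior_subset (hvN _ (hidx y)))
  have hpre : ∀ A : Set (range ρ), rangeFactorization ρ ⁻¹' A = ρ ⁻¹' (Subtype.val '' A) := by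
    intro A
    ext x
    simp [rangeFactorization]
  refine ⟨range ρ, rangeFactorization ρ, rangeFactorization_surjective, fun A => ?_, ?_⟩
  · rw [hpre]
    exact hloc _
  · rintro ⟨_, x, rfl⟩
    rw [hpre, image_singleton]
    exact hfib x

/-! ### Characters of `C_c(T)` and recovery of `T` -/

section BanachStone

variable {𝕜 : Type*} [RCLike 𝕜]

section Isomorphic

variable {S T U : Type*} [TopologicalSpace S] [TopologicalSpace T] [TopologicalSpace U]

theorem IsometricallyIsomorphic.symm {A : NonUnitalSubalgebra 𝕜 (S →ᵇ 𝕜)}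
    {B : NonUnitalSubalgebra 𝕜 (T →ᵇ 𝕜)} (h : IsometricallyIsomorphic A B) :
    IsometricallyIsomorphic B A := by
  obtain ⟨e, he⟩ := h
  refine ⟨e.symm, fun f g => e.injective ?_⟩
  simp [he]

theorem IsometricallyIsomorphic.trans {A : NonUnitalSubalgebra 𝕜 (S →ᵇ 𝕜)}
    {B : NonUnitalSubalgebra 𝕜 (T →ᵇ 𝕜)} {C : NonUnitalSubalgebra 𝕜 (U →ᵇ 𝕜)}
    (h : IsometricallyIsomorphic A B) (h' : IsometricallyIsomorphic B C) :
    IsometricallyIsomorphic A C := by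
  obtain ⟨e, he⟩ := h
  obtain ⟨e', he'⟩ := h'
  exact ⟨e.trans e', fun f g => by simp [he, he']⟩

end Isomorphic

section Characters

variable {T : Type*} [TopologicalSpace T]

/-- A continuous function with compact support as an element of `CCompact 𝕜 T`. -/
noncomputable def CCompact.mk (f : T → 𝕜) (hf : Continuous f) (hc : HasCompactSupport f) :
    CCompact 𝕜 T :=
  ⟨BoundedContinuousFunction.ofNormedAddCommGroup f hf _
    (hf.bounded_above_of_compact_support hc).choose_spec, hc⟩

@[simp]
theorem CCompact.mk_apply (f : T → 𝕜) (hf : Continuous f) (hc : HasCompactSupport f) (t : T) :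
    (CCompact.mk f hf hc : CCompact 𝕜 T).1 t = f t :=
  rfl

theorem CCompact.exists_eq_one [T2Space T] [LocallyCompactSpace T] {t : T} {U : Set T}
    (hU : IsOpen U) (ht : t ∈ U) : ∃ f : CCompact 𝕜 T, f.1 t = 1 ∧ ∀ x ∉ U, f.1 x = 0 := by
  obtain ⟨f, hf1, hf0, hfc, -⟩ := exists_continuous_one_zero_of_isCompact
    (isCompact_singleton (x := t)) hU.isClosed_compl
    (Set.disjoint_left.2 fun x hx hxU => hxU (mem_singleton_iff.1 hx ▸ ht))
  refine ⟨CCompact.mk (fun x => (f x : 𝕜)) (RCLike.continuous_ofReal.comp f.continuous)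
    (hfc.comp_left (g := fun r : ℝ => (r : 𝕜)) RCLike.ofReal_zero), ?_, fun x hx => ?_⟩
  · simp [hf1 (mem_singleton t)]
  · simp [hf0 hx]

/-- The nonzero multiplicative linear functionals on `C_c(T)` are the evaluations at points. -/
theorem CCompact.exists_eq_eval [T2Space T] [LocallyCompactSpace T]
    (χ : CCompact 𝕜 T →ₗ[𝕜] 𝕜) (hmul : ∀ f g, χ (f * g) = χ f * χ g) (hne : χ ≠ 0) :
    ∃ t, ∀ f : CCompact 𝕜 T, χ f = f.1 t := by
  obtain ⟨g, hg⟩ : ∃ g, χ g ≠ 0 := by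
    by_contra! h
    exact hne (LinearMap.ext h)
  have hgc : HasCompactSupport g.1 := g.2
  -- The kernel has a common zero. Otherwise compactness gives a finite sum `h` of functions `|f|²`
  -- in the kernel with no zero on the support of `g`, and then `g = h * (g / h)` would lie in the
  -- kernel.
  obtain ⟨t, ht⟩ : ∃ t, ∀ f : CCompact 𝕜 T, χ f = 0 → f.1 t = 0 := by
    by_contra! hcon
    obtain ⟨h, hχ, -, hpos⟩ : ∃ h : CCompact 𝕜 T, χ h = 0 ∧
        (∃ r : T → ℝ, (∀ x, 0 ≤ r x) ∧ ∀ x, h.1 x = r x) ∧ ∀ x ∈ tsupport g.1, h.1 x ≠ 0 := by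
      refine hgc.isCompact.induction_on (p := fun A => ∃ h : CCompact 𝕜 T, χ h = 0 ∧
        (∃ r : T → ℝ, (∀ x, 0 ≤ r x) ∧ ∀ x, h.1 x = r x) ∧ ∀ x ∈ A, h.1 x ≠ 0) ?_ ?_ ?_ ?_
      · exact ⟨0, map_zero χ, ⟨0, by simp, by simp⟩, by simp⟩
      · rintro A B hAB ⟨h, h1, h2, h3⟩
        exact ⟨h, h1, h2, fun x hx => h3 x (hAB hx)⟩
      · rintro A B ⟨h, h1, ⟨r, hr0, hr⟩, h3⟩ ⟨h', h1', ⟨r', hr0', hr'⟩, h3'⟩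
        refine ⟨h + h', by simp [h1, h1'], ⟨r + r', fun x => add_nonneg (hr0 x) (hr0' x),
          fun x => by simp [hr, hr']⟩, fun x hx hx0 => ?_⟩
        have hsum : r x + r' x = 0 := by
          have : ((r x + r' x : ℝ) : 𝕜) = 0 := by
            rw [← hx0]
            simp [hr, hr']
          exact_mod_cast this
        have h0 : r x = 0 := by linarith [hr0 x, hr0' x]
        have h0' : r' x = 0 := by linarith [hr0 x, hr0' x]
        rcases hx with hx | hx
        · exact h3 x hx (by simp [hr, h0])
        · exact h3' x hx (by simp [hr', h0'])
      · intro x _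
        obtain ⟨f, hf0, hfx⟩ := hcon x
        have hfc : HasCompactSupport f.1 := f.2
        let f' : CCompact 𝕜 T := CCompact.mk (fun y => star (f.1 y)) (by fun_prop)
          (hfc.comp_left (g := star) (star_zero 𝕜))
        refine ⟨{y | f.1 y ≠ 0}, mem_nhdsWithin_of_mem_nhds
          ((isOpen_ne_fun f.1.continuous continuous_const).mem_nhds hfx), f' * f, ?_,
          ⟨fun y => ‖f.1 y‖ ^ 2, fun y => by positivity, fun y => ?_⟩, fun y hy => ?_⟩
        · rw [hmul, hf0, mul_zero]
        · simpa [f'] using RCLike.conj_mul (f.1 y)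
        · simpa [f'] using hy
    have hsub : tsupport (fun x => g.1 x / h.1 x) ⊆ tsupport g.1 :=
      closure_mono fun x hx hx0 => hx (by simp [hx0])
    let q : CCompact 𝕜 T := CCompact.mk (fun x => g.1 x / h.1 x)
      (continuous_of_tsupport fun x hx =>
        g.1.continuous.continuousAt.div h.1.continuous.continuousAt (hpos x (hsub hx)))
      (hgc.of_isClosed_subset (isClosed_tsupport _) hsub)
    have hgq : g = h * q := by
      ext x
      change g.1 x = h.1 x * (g.1 x / h.1 x)
      by_cases hx : x ∈ tsupport g.1
      · rw [mul_div_cancel₀ _ (hpos x hx)]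
      · simp [image_eq_zero_of_notMem_tsupport hx]
    exact hg (by rw [hgq, hmul, hχ, zero_mul])
  have hcross : ∀ f : CCompact 𝕜 T, f.1 t * χ g = χ f * g.1 t := by
    intro f
    have h := ht (χ g • f - χ f • g) (by simp [mul_comm])
    simp [sub_eq_zero] at h
    rw [mul_comm, h]
  obtain ⟨f₁, hf₁, -⟩ := CCompact.exists_eq_one (𝕜 := 𝕜) isOpen_univ (mem_univ t)
  have hgt : g.1 t ≠ 0 := by
    intro h0
    have := hcross f₁
    simp [hf₁, h0, hg] at this
  have hgg : g.1 t = χ g := by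
    -- So far `χ` is only proportional to evaluation at `t`; multiplicativity at `g * g` makes the
    -- factor `1`.
    have h := hcross (g * g)
    rw [hmul] at h
    have h' : g.1 t * g.1 t * χ g = χ g * χ g * g.1 t := h
    have h2 : (g.1 t * χ g) * g.1 t = (g.1 t * χ g) * χ g := by linear_combination h'
    exact mul_left_cancel₀ (mul_ne_zero hgt hg) h2
  refine ⟨t, fun f => ?_⟩
  have := hcross f
  rw [hgg] at this
  exact (mul_right_cancel₀ hg this).symm

/-- Evaluation at `s` after `e` is a nonzero character, hence evaluation at some `τ s`. Continuity
holds because a bump function `f` inside `U` turns `{e f ≠ 0}` into an open subset of `τ ⁻¹' U`. -/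
theorem CCompact.exists_eq_comp {S : Type*} [TopologicalSpace S] [T2Space S]
    [LocallyCompactSpace S] [T2Space T] [LocallyCompactSpace T]
    (e : CCompact 𝕜 T ≃ₗᵢ[𝕜] CCompact 𝕜 S) (he : ∀ f g, e (f * g) = e f * e g) :
    ∃ τ : S → T, Continuous τ ∧ ∀ f s, (e f).1 s = f.1 (τ s) := by
  have hτ : ∀ s, ∃ t, ∀ f, (e f).1 s = f.1 t := by
    intro s
    let χ : CCompact 𝕜 T →ₗ[𝕜] 𝕜 :=
      { toFun := fun f => (e f).1 s
        map_add' := fun f g => by simp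
        map_smul' := fun c f => by simp }
    refine CCompact.exists_eq_eval χ (fun f g => ?_) fun h0 => ?_
    · change (e (f * g)).1 s = (e f).1 s * (e g).1 s
      rw [he]
      rfl
    · obtain ⟨g, hg, -⟩ := CCompact.exists_eq_one (𝕜 := 𝕜) isOpen_univ (mem_univ s)
      have h1 : χ (e.symm g) = 1 := by
        change (e (e.symm g)).1 s = 1
        rw [e.apply_symm_apply, hg]
      simp [h0] at h1
  choose τ hτ using hτ
  refine ⟨τ, ?_, fun f s => hτ s f⟩
  refine continuous_def.2 fun U hU => isOpen_iff_mem_nhds.2 fun s hs => ?_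
  obtain ⟨f, hf1, hf0⟩ := CCompact.exists_eq_one (𝕜 := 𝕜) hU hs
  have hopen : IsOpen {x | (e f).1 x ≠ 0} := isOpen_ne_fun (e f).1.continuous continuous_const
  refine mem_of_superset (hopen.mem_nhds ?_) fun x hx => ?_
  · simp [hτ, hf1]
  · by_contra hxU
    exact hx ((hτ x f).trans (hf0 _ hxU))

theorem CCompact.eq_of_forall_apply_eq [T2Space T] [LocallyCompactSpace T] {s t : T}
    (h : ∀ f : CCompact 𝕜 T, f.1 s = f.1 t) : s = t := by
  by_contra hst
  obtain ⟨f, hf1, hf0⟩ := CCompact.exists_eq_one (𝕜 := 𝕜) (isOpen_compl_singleton (x := t)) hst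
  have := h f
  rw [hf1, hf0 t (by simp)] at this
  exact one_ne_zero this

/-- Locally compact Hausdorff spaces with isometrically isomorphic algebras of compactly supported
functions are homeomorphic. -/
theorem nonempty_homeomorph_of_isometricallyIsomorphic {S : Type*} [TopologicalSpace S]
    [T2Space S] [LocallyCompactSpace S] [T2Space T] [LocallyCompactSpace T]
    (h : IsometricallyIsomorphic (CCompact 𝕜 S) (CCompact 𝕜 T)) : Nonempty (S ≃ₜ T) := by
  obtain ⟨e, he⟩ := h
  have he' : ∀ f g, e.symm (f * g) = e.symm f * e.symm g := fun f g =>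
    e.injective (by simp [he])
  obtain ⟨τ, hτ, hτe⟩ := CCompact.exists_eq_comp e he
  obtain ⟨σ, hσ, hσe⟩ := CCompact.exists_eq_comp e.symm he'
  exact ⟨{
    toFun := σ
    invFun := τ
    left_inv := fun s => CCompact.eq_of_forall_apply_eq (𝕜 := 𝕜) fun f => by
      rw [← hτe, ← hσe, e.symm_apply_apply]
    right_inv := fun t => CCompact.eq_of_forall_apply_eq (𝕜 := 𝕜) fun f => by
      rw [← hσe, ← hτe, e.apply_symm_apply] }⟩

end Characters

end BanachStone

/-! ### Lindelöf supports and countable sets of pieces -/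

section Fibers

variable {𝕜 : Type*} [RCLike 𝕜] {X Q : Type*} [TopologicalSpace X] {π : X → Q}

theorem countable_image_of_isLindelof (hπ : IsLocallyConstant π) {A : Set X}
    (hA : IsLindelof A) : (π '' A).Countable := by
  let : TopologicalSpace Q := ⊥
  have : DiscreteTopology Q := ⟨rfl⟩
  exact (hA.image hπ.continuous).countable_of_discrete

theorem isLindelof_preimage (hfib : ∀ q, IsLindelof (π ⁻¹' {q})) {S : Set Q}
    (hS : S.Countable) : IsLindelof (π ⁻¹' S) := by
  rw [← biUnion_preimage_singleton]
  exact hS.isLindelof_biUnion fun q _ => hfib q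

theorem closure_subset_preimage_image (hπ : IsLocallyConstant π) (A : Set X) :
    closure A ⊆ π ⁻¹' (π '' A) :=
  closure_minimal (subset_preimage_image π A) (isOpen_compl_iff.1 (hπ (π '' A)ᶜ))

theorem isLindelof_closure_iff (hπ : IsLocallyConstant π)
    (hfib : ∀ q, IsLindelof (π ⁻¹' {q})) {A : Set X} :
    IsLindelof (closure A) ↔ (π '' A).Countable :=
  ⟨fun h => (countable_image_of_isLindelof hπ h).mono (image_mono subset_closure), fun h =>
    (isLindelof_preimage hfib h).of_isClosed_subset isClosed_closure
      (closure_subset_preimage_image hπ A)⟩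

theorem mem_CLindelof_iff (hπ : IsLocallyConstant π) (hfib : ∀ q, IsLindelof (π ⁻¹' {q}))
    {f : X →ᵇ 𝕜} : f ∈ CLindelof 𝕜 X ↔ (π '' Function.support f).Countable := by
  constructor
  · rintro ⟨N, hN, hNL⟩
    exact (countable_image_of_isLindelof hπ hNL).mono
      (image_mono ((subset_tsupport f).trans (subset_of_mem_nhdsSet hN)))
  · intro h
    exact ⟨_, (hπ _).mem_nhdsSet.2 (closure_subset_preimage_image hπ _),
      isLindelof_preimage hfib h⟩

theorem CLindelof_eq (hπ : IsLocallyConstant π) (hfib : ∀ q, IsLindelof (π ⁻¹' {q})) :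
    CLindelof 𝕜 X = {f : X →ᵇ 𝕜 | IsLindelof (tsupport f)} :=
  Set.ext fun _ => (mem_CLindelof_iff hπ hfib).trans (isLindelof_closure_iff hπ hfib).symm

/-- `C_P(X)` as a subalgebra, for a disjoint union `X` of clopen Lindelöf subspaces. -/
noncomputable def CLindelofSubalgebra (𝕜 : Type*) [RCLike 𝕜] (hπ : IsLocallyConstant π)
    (hfib : ∀ q, IsLindelof (π ⁻¹' {q})) : NonUnitalSubalgebra 𝕜 (X →ᵇ 𝕜) where
  carrier := CLindelof 𝕜 X
  add_mem' {f g} hf hg := by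
    rw [mem_CLindelof_iff hπ hfib] at hf hg ⊢
    refine (hf.union hg).mono ?_
    rw [← image_union]
    exact image_mono (Function.support_add f g)
  zero_mem' := by
    rw [mem_CLindelof_iff hπ hfib]
    simp
  mul_mem' {f g} hf _ := by
    rw [mem_CLindelof_iff hπ hfib] at hf ⊢
    exact hf.mono (image_mono (Function.support_mul_subset_left f g))
  smul_mem' c f hf := by
    rw [mem_CLindelof_iff hπ hfib] at hf ⊢
    exact hf.mono (image_mono (Function.support_const_smul_subset c f))

/-- The cozero-set of a limit of a sequence lies in the union of the cozero-sets of its terms. -/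
theorem isClosed_CLindelof (hπ : IsLocallyConstant π) (hfib : ∀ q, IsLindelof (π ⁻¹' {q})) :
    IsClosed (CLindelof 𝕜 X) := by
  refine isClosed_of_closure_subset fun f hf => ?_
  obtain ⟨u, hu, huf⟩ := mem_closure_iff_seq_limit.1 hf
  rw [mem_CLindelof_iff hπ hfib]
  refine (countable_iUnion fun n => (mem_CLindelof_iff hπ hfib).1 (hu n)).mono ?_
  rintro _ ⟨x, hx, rfl⟩
  by_contra hcon
  simp only [mem_iUnion, not_exists] at hcon
  have hzero : ∀ n, u n x = 0 := fun n => by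
    by_contra hne
    exact hcon n (mem_image_of_mem π hne)
  have hlim : Tendsto (fun n => u n x) atTop (𝓝 (f x)) :=
    ((continuous_eval_const x).tendsto f).comp huf
  simp only [hzero] at hlim
  exact hx (tendsto_nhds_unique tendsto_const_nhds hlim).symm

theorem support_eq_iUnion_le_norm {Z : Type*} (f : Z → 𝕜) :
    Function.support f = ⋃ n : ℕ, {x | 1 / ((n : ℝ) + 1) ≤ ‖f x‖} := by
  ext x
  simp only [Function.mem_support, mem_iUnion, mem_ofPred_eq]
  constructor
  · intro hx
    obtain ⟨n, hn⟩ := exists_nat_one_div_lt (norm_pos_iff.2 hx)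
    exact ⟨n, hn.le⟩
  · rintro ⟨n, hn⟩
    exact norm_pos_iff.1 (lt_of_lt_of_le Nat.one_div_pos_of_nat hn)

theorem CZero_subset_CLindelof (hπ : IsLocallyConstant π)
    (hfib : ∀ q, IsLindelof (π ⁻¹' {q})) : CZero 𝕜 X ⊆ CLindelof 𝕜 X := by
  intro f hf
  rw [mem_CLindelof_iff hπ hfib, support_eq_iUnion_le_norm, image_iUnion]
  exact countable_iUnion fun n =>
    countable_image_of_isLindelof hπ (hf _ Nat.one_div_pos_of_nat).isLindelof

open Classical in
/-- The indicator function of the preimage of `S` under a locally constant map. -/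
noncomputable def preimageIndicator (𝕜 : Type*) [RCLike 𝕜] (hπ : IsLocallyConstant π) (S : Set Q) : X →ᵇ 𝕜 :=
  BoundedContinuousFunction.ofNormedAddCommGroup (fun x => if π x ∈ S then 1 else 0)
    (hπ.comp fun q => if q ∈ S then (1 : 𝕜) else 0).continuous 1
    fun x => by split_ifs <;> simp

theorem support_preimageIndicator (hπ : IsLocallyConstant π) (S : Set Q) :
    Function.support (preimageIndicator 𝕜 hπ S) = π ⁻¹' S := by
  ext x
  simp [preimageIndicator]

theorem CZero_ssubset_CLindelof [Infinite Q] (hsurj : Function.Surjective π)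
    (hπ : IsLocallyConstant π) (hfib : ∀ q, IsLindelof (π ⁻¹' {q})) :
    CZero 𝕜 X ⊂ CLindelof 𝕜 X := by
  refine (ssubset_iff_of_subset (CZero_subset_CLindelof hπ hfib)).2 ?_
  let S : Set Q := range (Infinite.natEmbedding Q)
  -- The indicator of countably infinitely many pieces: its support is Lindelöf, but compact sets
  -- meet only finitely many pieces.
  refine ⟨preimageIndicator 𝕜 hπ S, ?_, fun h => ?_⟩
  · rw [mem_CLindelof_iff hπ hfib, support_preimageIndicator, image_preimage_eq S hsurj]
    exact countable_range _
  · have hset : {x | 1 ≤ ‖preimageIndicator 𝕜 hπ S x‖} = π ⁻¹' S := by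
      ext x
      by_cases hx : π x ∈ S <;> simp [preimageIndicator, hx]
    have hc := h 1 one_pos
    rw [hset] at hc
    let : TopologicalSpace Q := ⊥
    have : DiscreteTopology Q := ⟨rfl⟩
    have hfin := (hc.image hπ.continuous).finite_of_discrete
    rw [image_preimage_eq S hsurj] at hfin
    exact infinite_range_of_injective (Infinite.natEmbedding Q).injective hfin

theorem isSigmaCompact_iff_isLindelof [LocallyCompactSpace X] {A : Set X} (hA : IsClosed A) :
    IsSigmaCompact A ↔ IsLindelof A := by
  refine ⟨fun h => h.isLindelof, fun h => ?_⟩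
  choose K hK hKx using fun x : X => exists_compact_mem_nhds x
  obtain ⟨t, ht, -, hAt⟩ := h.elim_nhds_subcover K fun x _ => hKx x
  exact (isSigmaCompact_biUnion ht fun x _ => (hK x).isSigmaCompact).of_isClosed_subset hA hAt

end Fibers

/-! ### The space `λ_P X` over the ultrafilters on `Q` -/

section Lambda

variable {𝕜 : Type*} [RCLike 𝕜] {X Q : Type*} [TopologicalSpace X] {π : X → Q}

/-- The extension of a locally constant map `X → Q` to a map from `βX` to the ultrafilters
on `Q`. -/
noncomputable def toUltrafilter (hπ : IsLocallyConstant π) : StoneCech X → Ultrafilter Q :=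
  stoneCechExtend (g := fun x => (pure (π x) : Ultrafilter Q)) (hπ.comp pure).continuous

theorem continuous_toUltrafilter (hπ : IsLocallyConstant π) : Continuous (toUltrafilter hπ) :=
  continuous_stoneCechExtend _

@[simp]
theorem toUltrafilter_unit (hπ : IsLocallyConstant π) (x : X) :
    toUltrafilter hπ (stoneCechUnit x) = pure (π x) :=
  stoneCechExtend_stoneCechUnit _ x

theorem isOpen_mem_toUltrafilter (hπ : IsLocallyConstant π) (S : Set Q) :
    IsOpen {p | S ∈ toUltrafilter hπ p} :=
  (ultrafilter_isOpen_basic S).preimage (continuous_toUltrafilter hπ)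

theorem isClosed_mem_toUltrafilter (hπ : IsLocallyConstant π) (S : Set Q) :
    IsClosed {p | S ∈ toUltrafilter hπ p} :=
  (ultrafilter_isClosed_basic S).preimage (continuous_toUltrafilter hπ)

/-- The right side is clopen in `βX`, and `X` is dense. -/
theorem closure_image_preimage_eq (hπ : IsLocallyConstant π) (S : Set Q) :
    closure (stoneCechUnit '' (π ⁻¹' S)) = {p | S ∈ toUltrafilter hπ p} := by
  refine Subset.antisymm (closure_minimal ?_ (isClosed_mem_toUltrafilter hπ S)) ?_
  · rintro _ ⟨x, hx, rfl⟩
    simpa using hx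
  · refine (denseRange_stoneCechUnit.open_subset_closure_inter
      (isOpen_mem_toUltrafilter hπ S)).trans (closure_mono ?_)
    rintro _ ⟨hp, x, rfl⟩
    exact ⟨x, by simpa using hp, rfl⟩

theorem mem_lambdaLindelof_iff (hπ : IsLocallyConstant π)
    (hfib : ∀ q, IsLindelof (π ⁻¹' {q})) {p : StoneCech X} :
    p ∈ lambdaLindelof 𝕜 X ↔ toUltrafilter hπ p ∈ countableUltrafilters Q := by
  simp only [lambdaLindelof, mem_iUnion, exists_prop]
  constructor
  · rintro ⟨C, ⟨-, hC⟩, hp⟩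
    refine ⟨π '' C, ?_, (isLindelof_closure_iff hπ hfib).1 hC⟩
    have h := closure_mono (image_mono (subset_preimage_image π C)) (interior_subset hp)
    rwa [closure_image_preimage_eq hπ] at h
  · rintro ⟨S, hS, hSc⟩
    refine ⟨π ⁻¹' S, ⟨⟨preimageIndicator 𝕜 hπ S, (support_preimageIndicator hπ S).symm⟩, ?_⟩, ?_⟩
    · exact (isLindelof_closure_iff hπ hfib).2 (hSc.mono (image_preimage_subset π S))
    · rw [closure_image_preimage_eq hπ, (isOpen_mem_toUltrafilter hπ S).interior_eq]
      exact hS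

theorem isOpen_lambdaLindelof : IsOpen (lambdaLindelof 𝕜 X) :=
  isOpen_biUnion fun _ _ => isOpen_interior

instance : LocallyCompactSpace (lambdaLindelof 𝕜 X) :=
  isOpen_lambdaLindelof.locallyCompactSpace

/-- The clopen part of `λ_P X` lying over a set `S` of indices. -/
noncomputable def lambdaPart (𝕜 : Type*) [RCLike 𝕜] (hπ : IsLocallyConstant π) (S : Set Q) :
    Set (lambdaLindelof 𝕜 X) :=
  {y | S ∈ toUltrafilter hπ y.1}

theorem isOpen_lambdaPart (hπ : IsLocallyConstant π) (S : Set Q) :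
    IsOpen (lambdaPart 𝕜 hπ S) :=
  (isOpen_mem_toUltrafilter hπ S).preimage continuous_subtype_val

theorem lambdaPart_mono (hπ : IsLocallyConstant π) {S S' : Set Q} (h : S ⊆ S') :
    lambdaPart 𝕜 hπ S ⊆ lambdaPart 𝕜 hπ S' :=
  fun _ hy => mem_of_superset hy h

theorem isCompact_lambdaPart (hπ : IsLocallyConstant π) (hfib : ∀ q, IsLindelof (π ⁻¹' {q}))
    {S : Set Q} (hS : S.Countable) : IsCompact (lambdaPart 𝕜 hπ S) := by
  rw [Subtype.isCompact_iff]
  have h : Subtype.val '' lambdaPart 𝕜 hπ S = {p | S ∈ toUltrafilter hπ p} := by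
    ext p
    constructor
    · rintro ⟨y, hy, rfl⟩
      exact hy
    · exact fun hp => ⟨⟨p, (mem_lambdaLindelof_iff hπ hfib).2 ⟨S, hp, hS⟩⟩, hp, rfl⟩
  rw [h]
  exact (isClosed_mem_toUltrafilter hπ S).isCompact

theorem exists_mem_lambdaPart (hπ : IsLocallyConstant π) (hfib : ∀ q, IsLindelof (π ⁻¹' {q}))
    (y : lambdaLindelof 𝕜 X) : ∃ S : Set Q, S.Countable ∧ y ∈ lambdaPart 𝕜 hπ S := by
  obtain ⟨S, hS, hSc⟩ := (mem_lambdaLindelof_iff hπ hfib).1 y.2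
  exact ⟨S, hSc, hS⟩

theorem exists_subset_lambdaPart (hπ : IsLocallyConstant π) (hfib : ∀ q, IsLindelof (π ⁻¹' {q}))
    {A : Set (lambdaLindelof 𝕜 X)} (hA : IsCompact A) :
    ∃ S : Set Q, S.Countable ∧ A ⊆ lambdaPart 𝕜 hπ S := by
  refine hA.induction_on (p := fun A => ∃ S : Set Q, S.Countable ∧ A ⊆ lambdaPart 𝕜 hπ S)
    ⟨∅, countable_empty, empty_subset _⟩ ?_ ?_ ?_
  · rintro A B hAB ⟨S, hS, hB⟩
    exact ⟨S, hS, hAB.trans hB⟩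
  · rintro A B ⟨S, hS, hA⟩ ⟨S', hS', hB⟩
    exact ⟨S ∪ S', hS.union hS', union_subset (hA.trans (lambdaPart_mono hπ subset_union_left))
      (hB.trans (lambdaPart_mono hπ subset_union_right))⟩
  · intro y _
    obtain ⟨S, hS, hy⟩ := exists_mem_lambdaPart hπ hfib y
    exact ⟨_, mem_nhdsWithin_of_mem_nhds ((isOpen_lambdaPart hπ S).mem_nhds hy), S, hS,
      Subset.rfl⟩

theorem CCompact_lambdaLindelof_eq_CZero (hπ : IsLocallyConstant π)
    (hfib : ∀ q, IsLindelof (π ⁻¹' {q})) :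
    (CCompact 𝕜 (lambdaLindelof 𝕜 X) : Set (lambdaLindelof 𝕜 X →ᵇ 𝕜)) =
      CZero 𝕜 (lambdaLindelof 𝕜 X) := by
  ext f
  constructor
  · intro (hf : HasCompactSupport f) ε hε
    refine hf.isCompact.of_isClosed_subset
      (isClosed_le continuous_const f.continuous.norm) fun y hy => subset_tsupport f ?_
    exact norm_pos_iff.1 (hε.trans_le hy)
  · intro hf
    choose S hS hfS using fun n : ℕ =>
      exists_subset_lambdaPart hπ hfib (hf (1 / ((n : ℝ) + 1)) Nat.one_div_pos_of_nat)
    refine HasCompactSupport.of_support_subset_isCompact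
      (isCompact_lambdaPart hπ hfib (countable_iUnion hS)) ?_
    rw [support_eq_iUnion_le_norm]
    exact iUnion_subset fun n => (hfS n).trans (lambdaPart_mono hπ (subset_iUnion S n))

/-- A sequence meets countably many parts with countable index sets, so it stays in the compact part
over their union. -/
theorem countablyCompactSpace_lambdaLindelof (hπ : IsLocallyConstant π)
    (hfib : ∀ q, IsLindelof (π ⁻¹' {q})) :
    CountablyCompactSpace (lambdaLindelof 𝕜 X) := by
  rw [← isCountablyCompact_univ_iff, isCountablyCompact_iff_seq_clusterPt]
  intro y _
  choose S hS hyS using fun n => exists_mem_lambdaPart hπ hfib (y n)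
  obtain ⟨a, -, ha⟩ :=
    (isCompact_lambdaPart hπ hfib (countable_iUnion hS)).isCountablyCompact.seq_clusterPt y
      (Eventually.of_forall fun n => lambdaPart_mono hπ (subset_iUnion S n) (hyS n))
  exact ⟨a, mem_univ a, ha⟩

theorem not_normalSpace_lambdaLindelof [Uncountable Q] (hsurj : Function.Surjective π)
    (hπ : IsLocallyConstant π) (hfib : ∀ q, IsLindelof (π ⁻¹' {q})) :
    ¬ NormalSpace (lambdaLindelof 𝕜 X) := by
  intro hnormal
  refine not_normalSpace_countableUltrafilters Q ?_
  obtain ⟨s, hs⟩ := hsurj.hasRightInverse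
  -- The extension of a section of `π` is a continuous section of `toUltrafilter`; the identity need
  -- only be checked on the dense principal ultrafilters.
  let φ : Ultrafilter Q → StoneCech X := Ultrafilter.extend fun q => stoneCechUnit (s q)
  have hφ : Continuous φ := continuous_ultrafilter_extend _
  have hid : ∀ u, toUltrafilter hπ (φ u) = u := by
    refine congrFun (denseRange_pure.equalizer ((continuous_toUltrafilter hπ).comp hφ)
      continuous_id (funext fun q => ?_))
    simp [φ, hs q]
  have hleft : Function.LeftInverse
      (fun y : lambdaLindelof 𝕜 X => (⟨toUltrafilter hπ y.1,
        (mem_lambdaLindelof_iff hπ hfib).1 y.2⟩ : countableUltrafilters Q))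
      (fun u => ⟨φ u.1, (mem_lambdaLindelof_iff hπ hfib).2 ((hid u.1).symm ▸ u.2)⟩) :=
    fun u => Subtype.ext (hid u.1)
  exact (hleft.isClosedEmbedding
    (((continuous_toUltrafilter hπ).comp continuous_subtype_val).subtype_mk _)
    ((hφ.comp continuous_subtype_val).subtype_mk _)).normalSpace

/-- The canonical map from `X` to `λ_P X`. -/
noncomputable def toLambda (𝕜 : Type*) [RCLike 𝕜] (hπ : IsLocallyConstant π)
    (hfib : ∀ q, IsLindelof (π ⁻¹' {q})) : C(X, lambdaLindelof 𝕜 X) where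
  toFun x := ⟨stoneCechUnit x, (mem_lambdaLindelof_iff hπ hfib).2
    ⟨{π x}, by simp, countable_singleton _⟩⟩
  continuous_toFun := continuous_stoneCechUnit.subtype_mk _

theorem denseRange_toLambda (hπ : IsLocallyConstant π) (hfib : ∀ q, IsLindelof (π ⁻¹' {q})) :
    DenseRange (toLambda 𝕜 hπ hfib) := by
  refine (denseRange_stoneCechUnit.preimage
    (isOpen_lambdaLindelof (𝕜 := 𝕜) (X := X)).isOpenMap_subtype_val).mono ?_
  rintro y ⟨x, hx⟩
  exact ⟨x, Subtype.ext hx⟩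

/-- The restriction of compactly supported functions from `λ_P X` to `X`. -/
noncomputable def restrictToLindelof (𝕜 : Type*) [RCLike 𝕜] (hπ : IsLocallyConstant π)
    (hfib : ∀ q, IsLindelof (π ⁻¹' {q})) :
    CCompact 𝕜 (lambdaLindelof 𝕜 X) →ₗᵢ[𝕜] CLindelofSubalgebra 𝕜 hπ hfib where
  toFun g := ⟨g.1.compContinuous (toLambda 𝕜 hπ hfib), by
    obtain ⟨S, hS, hgS⟩ := exists_subset_lambdaPart hπ hfib (show HasCompactSupport g.1 from g.2)
    refine (mem_CLindelof_iff hπ hfib).2 (hS.mono ?_)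
    rintro _ ⟨x, hx, rfl⟩
    have h : S ∈ toUltrafilter hπ (stoneCechUnit x) := hgS (subset_tsupport _ hx)
    simpa using h⟩
  map_add' _ _ := rfl
  map_smul' _ _ := rfl
  norm_map' g := by
    refine le_antisymm ((BoundedContinuousFunction.norm_le (norm_nonneg _)).2 fun x =>
      g.1.norm_coe_le_norm _) ?_
    refine (BoundedContinuousFunction.norm_le (norm_nonneg _)).2 fun y => ?_
    refine (denseRange_toLambda (𝕜 := 𝕜) hπ hfib).induction_on
      (p := fun y => ‖g.1 y‖ ≤ ‖g.1.compContinuous (toLambda 𝕜 hπ hfib)‖) y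
      (isClosed_le g.1.continuous.norm continuous_const) fun x => ?_
    exact (g.1.compContinuous (toLambda 𝕜 hπ hfib)).norm_coe_le_norm x

theorem restrictToLindelof_surjective (hπ : IsLocallyConstant π)
    (hfib : ∀ q, IsLindelof (π ⁻¹' {q})) :
    Function.Surjective (restrictToLindelof 𝕜 hπ hfib) := by
  rintro ⟨f, hf⟩
  have hS := (mem_CLindelof_iff hπ hfib).1 hf
  let f' : X → Metric.closedBall (0 : 𝕜) ‖f‖ := fun x =>
    ⟨f x, mem_closedBall_zero_iff.2 (f.norm_coe_le_norm x)⟩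
  have hf' : Continuous f' := f.continuous.subtype_mk _
  let G : StoneCech X → 𝕜 := fun p => (stoneCechExtend hf' p : Metric.closedBall (0 : 𝕜) ‖f‖).1
  have hG : Continuous G := continuous_subtype_val.comp (continuous_stoneCechExtend hf')
  have hGx : ∀ x, G (stoneCechUnit x) = f x := fun x => by
    simp only [G, stoneCechExtend_stoneCechUnit, f']
  -- Both conditions are open in `p`, as is the negation of the second, so a counterexample could be
  -- moved to a point of `X`.
  have hsupp : ∀ p, G p ≠ 0 → π '' Function.support f ∈ toUltrafilter hπ p := by
    intro p hp
    by_contra hcon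
    obtain ⟨_, ⟨hx0, hxS⟩, x, rfl⟩ := denseRange_stoneCechUnit.inter_open_nonempty _
      ((isOpen_ne_fun hG continuous_const).inter
        (isOpen_mem_toUltrafilter hπ (π '' Function.support f)ᶜ))
      ⟨p, hp, Ultrafilter.compl_mem_iff_notMem.2 hcon⟩
    have h : π x ∉ π '' Function.support f := by simpa using hxS
    exact h ⟨x, fun h0 => hx0 ((hGx x).trans h0), rfl⟩
  let g : lambdaLindelof 𝕜 X → 𝕜 := fun y => G y.1
  have hgc : HasCompactSupport g :=
    HasCompactSupport.of_support_subset_isCompact (isCompact_lambdaPart hπ hfib hS)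
      fun y hy => hsupp y.1 hy
  refine ⟨CCompact.mk g (hG.comp continuous_subtype_val) hgc, Subtype.ext ?_⟩
  ext x
  exact hGx x

theorem isometricallyIsomorphic_lambdaLindelof (hπ : IsLocallyConstant π)
    (hfib : ∀ q, IsLindelof (π ⁻¹' {q})) :
    IsometricallyIsomorphic (CLindelofSubalgebra 𝕜 hπ hfib)
      (CCompact 𝕜 (lambdaLindelof 𝕜 X)) :=
  IsometricallyIsomorphic.symm
    ⟨LinearIsometryEquiv.ofSurjective (restrictToLindelof 𝕜 hπ hfib)
      (restrictToLindelof_surjective hπ hfib), fun _ _ => rfl⟩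

end Lambda

end LindelofSupport

end

theorem theorem4p4 {𝕜 : Type*} [RCLike 𝕜] (X : Type*) [TopologicalSpace X] [T2Space X]
    [ParacompactSpace X] (hX : LindelofSupport.LocallyLindelof X) :
    (∃ A : NonUnitalSubalgebra 𝕜 (X →ᵇ 𝕜),
      (A : Set (X →ᵇ 𝕜)) = LindelofSupport.CLindelof 𝕜 X ∧
      CompleteSpace A ∧
      (T2Space (LindelofSupport.lambdaLindelof 𝕜 X) ∧
        LocallyCompactSpace (LindelofSupport.lambdaLindelof 𝕜 X) ∧
        LindelofSupport.IsometricallyIsomorphic A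
          (LindelofSupport.CCompact 𝕜 (LindelofSupport.lambdaLindelof 𝕜 X))) ∧
      (∀ (T : Type*) [TopologicalSpace T] [T2Space T] [LocallyCompactSpace T],
        LindelofSupport.IsometricallyIsomorphic A (LindelofSupport.CCompact 𝕜 T) →
          Nonempty (T ≃ₜ LindelofSupport.lambdaLindelof 𝕜 X))) ∧
    LindelofSupport.CLindelof 𝕜 X = {f : X →ᵇ 𝕜 | IsLindelof (tsupport f)} ∧
    LindelofSupport.CZero 𝕜 X ⊆ LindelofSupport.CLindelof 𝕜 X ∧
    (¬ LindelofSpace X → LindelofSupport.CZero 𝕜 X ⊂ LindelofSupport.CLindelof 𝕜 X) ∧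
    (LindelofSupport.CCompact 𝕜 (LindelofSupport.lambdaLindelof 𝕜 X) :
        Set (LindelofSupport.lambdaLindelof 𝕜 X →ᵇ 𝕜)) =
      LindelofSupport.CZero 𝕜 (LindelofSupport.lambdaLindelof 𝕜 X) ∧
    CountablyCompactSpace (LindelofSupport.lambdaLindelof 𝕜 X) ∧
    (¬ LindelofSpace X →
      ¬ LindelofSpace (LindelofSupport.lambdaLindelof 𝕜 X) ∧
      ¬ ParacompactSpace (LindelofSupport.lambdaLindelof 𝕜 X)) ∧
    (LocallyCompactSpace X →
      LindelofSupport.CLindelof 𝕜 X = {f : X →ᵇ 𝕜 | IsSigmaCompact (tsupport f)} ∧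
      (¬ LindelofSpace X → ¬ NormalSpace (LindelofSupport.lambdaLindelof 𝕜 X))) := by
  obtain ⟨Q, π, hsurj, hπ, hfib⟩ :=
    LindelofSupport.exists_isLocallyConstant_isLindelof_fiber X hX
  have hQ : ¬ LindelofSpace X → Uncountable Q := by
    intro hL
    by_contra hc
    rw [not_uncountable_iff] at hc
    exact hL (isLindelof_univ_iff.1
      (LindelofSupport.isLindelof_preimage hfib (Set.countable_univ (α := Q))))
  have hnormal : ¬ LindelofSpace X → ¬ NormalSpace (LindelofSupport.lambdaLindelof 𝕜 X) := by
    intro hL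
    have := hQ hL
    exact LindelofSupport.not_normalSpace_lambdaLindelof hsurj hπ hfib
  have hcc : CountablyCompactSpace (LindelofSupport.lambdaLindelof 𝕜 X) :=
    LindelofSupport.countablyCompactSpace_lambdaLindelof hπ hfib
  have hiso := LindelofSupport.isometricallyIsomorphic_lambdaLindelof (𝕜 := 𝕜) hπ hfib
  refine ⟨⟨LindelofSupport.CLindelofSubalgebra 𝕜 hπ hfib, rfl,
      (LindelofSupport.isClosed_CLindelof hπ hfib).completeSpace_coe,
      ⟨inferInstance, inferInstance, hiso⟩, ?_⟩,
    LindelofSupport.CLindelof_eq hπ hfib, LindelofSupport.CZero_subset_CLindelof hπ hfib, ?_,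
    LindelofSupport.CCompact_lambdaLindelof_eq_CZero hπ hfib, hcc, ?_, ?_⟩
  · intro T _ _ _ hT
    exact LindelofSupport.nonempty_homeomorph_of_isometricallyIsomorphic (hT.symm.trans hiso)
  · intro hL
    have := hQ hL
    exact LindelofSupport.CZero_ssubset_CLindelof hsurj hπ hfib
  · intro hL
    -- Lindelöf together with countably compact gives compact; compact Hausdorff and paracompact
    -- Hausdorff spaces are normal.
    refine ⟨fun h => hnormal hL ?_, fun h => hnormal hL inferInstance⟩
    have : CompactSpace (LindelofSupport.lambdaLindelof 𝕜 X) :=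
      ⟨isLindelof_univ.isCompact hcc.isCountablyCompact_univ⟩
    infer_instance
  · intro hlc
    refine ⟨?_, hnormal⟩
    rw [LindelofSupport.CLindelof_eq hπ hfib]
    ext f
    exact (LindelofSupport.isSigmaCompact_iff_isLindelof (isClosed_tsupport f)).symm
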